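/- Let $m\ge 1$ and $l\ge m+2$ be integers, let $n=2l-2$, and let $\{P_0,\dots,P_m\}$ be a symmetric Clifford system on $\mathbb{R}^{2l}$, i.e. symmetric real $2l\times 2l$ matrices with $P_iP_j+P_jP_i=2\delta_{ij}I_{2l}$. Let $f$ be the restriction to the unit sphere $S^{n+1}(1)=S^{2l-1}\subset\mathbb{R}^{2l}$ of $F(x)=|x|^4-2\sum_{\alpha=0}^m\langle P_\alpha x,x\rangle^2$, and let $M^n=f^{-1}(c_0)$, $-1<c_0<1$, be the FKM-type isoparametric hypersurface that is minimal in $S^{n+1}(1)$. Let $P=\sum_\alpha a_\alpha P_\alpha$ with $\sum_\alpha a_\alpha^2=1$, and let $\varphi_2:M^n\to\mathbb{R}$, $\varphi_2(x)=\langle Px,x\rangle$. Let $M_+=f^{-1}(1)$, and let $N_+$ and $N_-$ be the focal submanifolds of $\varphi_2$, i.e. the subsets of $M^n$ where $\varphi_2$ attains its maximum and its minimum. Then $$M_+=\{x\in S^{n+1}(1):\langle P_\alpha x,x\rangle=0\text{ for all }\alpha=0,\dots,m\},\qquad N_\pm=\Big\{x\in M^n:\varphi_2(x)=\pm\sqrt{\tfrac{1-c_0}{2}}\Big\},$$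 the sets $M_+$, $N_+$ and $N_-$ are smooth embedded submanifolds of dimension $n-m$, and they are diffeomorphic to one another. Explicitly, there is a real number $t$ with $$\cos t=\sqrt{\tfrac12\Big(1+\sqrt{\tfrac{1+c_0}{2}}\Big)},\qquad \sin t=\sqrt{\tfrac12\Big(1-\sqrt{\tfrac{1+c_0}{2}}\Big)},$$ for which $x\mapsto \cos t\,x+\sin t\,Px$ is a diffeomorphism from $M_+$ onto $N_+$ and $x\mapsto\cos t\,x-\sin t\,Px$ is a diffeomorphism from $M_+$ onto $N_-$. Moreover, in the improper case $m=1$, every level set $\varphi_2^{-1}(\tau)$ with $-\sqrt{\tfrac{1-c_0}{2}}\le\tau\le\sqrt{\tfrac{1-c_0}{2}}$ is an $(n-1)$-dimensional minimal submanifold (a minimal hypersurface) of $M^n$. -/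

import Mathlib

open scoped ContDiff Topology RealInnerProductSpace

noncomputable section

namespace FKM

/-! Embedded submanifolds of a Euclidean space, diffeomorphisms between them, minimality. -/

section Submanifolds

variable {E : Type*} [NormedAddCommGroup E] [InnerProductSpace ℝ E] [FiniteDimensional ℝ E]

/-- `S` is a smooth embedded `d`-dimensional submanifold of `E`: around each of its points there is
a smooth diffeomorphism between open subsets of `E` that flattens `S` to a `d`-dimensional linear
subspace. -/
def IsSubmanifold (d : ℕ) (S : Set E) : Prop :=
  ∀ x ∈ S, ∃ (Φ : OpenPartialHomeomorph E E) (L : Submodule ℝ E),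
    Module.finrank ℝ L = d ∧ x ∈ Φ.source ∧
    ContDiffOn ℝ ∞ Φ Φ.source ∧ ContDiffOn ℝ ∞ Φ.symm Φ.target ∧
    ∀ y ∈ Φ.source, y ∈ S ↔ Φ y ∈ L

/-- `h` is smooth on the subset `A` of `E`: near each point of `A` it agrees on `A` with a smooth
map defined on an open subset of `E`. -/
def IsSmoothOnSubset (h : E → E) (A : Set E) : Prop :=
  ∀ x ∈ A, ∃ (U : Set E) (g : E → E), IsOpen U ∧ x ∈ U ∧ ContDiffOn ℝ ∞ g U ∧
    Set.EqOn g h (U ∩ A)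

/-- `h` restricts to a diffeomorphism from `A` onto `B`. -/
def IsDiffeomorphism (h : E → E) (A B : Set E) : Prop :=
  Set.MapsTo h A B ∧ IsSmoothOnSubset h A ∧
    ∃ k : E → E, Set.MapsTo k B A ∧ IsSmoothOnSubset k B ∧ Set.InvOn k h A B

/-- `γ` is, near time `0`, a smooth curve in `S` through `x` at time `0`. -/
def IsCurveIn (S : Set E) (x : E) (γ : ℝ → E) : Prop :=
  γ 0 = x ∧ ∃ ε > 0, ContDiffOn ℝ ∞ γ (Set.Ioo (-ε) ε) ∧ ∀ t ∈ Set.Ioo (-ε) ε, γ t ∈ S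

/-- The tangent space of `S` at `x`, spanned by the velocities of the curves in `S` through `x`
(for a submanifold these velocities form a linear subspace already). -/
def tangentSpaceAt (S : Set E) (x : E) : Submodule ℝ E :=
  Submodule.span ℝ {v | ∃ γ : ℝ → E, IsCurveIn S x γ ∧ deriv γ 0 = v}

/-- The normal space at `x` of `S` in the ambient submanifold `A`: the orthogonal complement of
the tangent space of `S` within the tangent space of `A`. -/
def normalSpaceIn (A S : Set E) (x : E) : Submodule ℝ E :=
  tangentSpaceAt A x ⊓ (tangentSpaceAt S x)ᗮ

/-- `S` is a `d`-dimensional minimal submanifold of the `k`-dimensional submanifold `A` of `E`,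
both with the metric induced from `E`. The second fundamental form of `S` in `A` on a tangent
vector `v` is the component, normal to `S` and tangent to `A`, of the acceleration of any curve in
`S` with velocity `v`; the mean curvature vector is its trace over an orthonormal basis. -/
structure IsMinimalIn (k d : ℕ) (A S : Set E) : Prop where
  ambient : IsSubmanifold k A
  submanifold : IsSubmanifold d S
  subset : S ⊆ A
  mean_curvature_eq_zero : ∀ x ∈ S, ∀ e : OrthonormalBasis (Fin d) ℝ (tangentSpaceAt S x),
    ∀ γ : Fin d → ℝ → E, (∀ i, IsCurveIn S x (γ i) ∧ deriv (γ i) 0 = (e i : E)) →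
      ∑ i, (normalSpaceIn A S x).starProjection (deriv (deriv (γ i)) 0) = 0

end Submanifolds

/-! Clifford systems and the hypersurfaces they define. -/

section Clifford

variable {l m : ℕ}

/-- A symmetric Clifford system `P₀, …, Pₘ` on `ℝ^(2l)`. -/
structure IsCliffordSystem (P : Fin (m + 1) → Matrix (Fin (2 * l)) (Fin (2 * l)) ℝ) : Prop where
  symm : ∀ i, (P i).IsSymm
  anticomm : ∀ i j, P i * P j + P j * P i = if i = j then (2 : ℝ) • 1 else 0

/-- The Clifford sphere: the unit sphere in the span of `P₀, …, Pₘ`, in which the `P_α` are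
orthonormal. -/
def cliffordSphere (P : Fin (m + 1) → Matrix (Fin (2 * l)) (Fin (2 * l)) ℝ) :
    Set (Matrix (Fin (2 * l)) (Fin (2 * l)) ℝ) :=
  {Q | ∃ a : Fin (m + 1) → ℝ, ∑ α, a α ^ 2 = 1 ∧ Q = ∑ α, a α • P α}

/-- The linear action of a matrix on Euclidean space. -/
def act (A : Matrix (Fin (2 * l)) (Fin (2 * l)) ℝ) :
    EuclideanSpace ℝ (Fin (2 * l)) →L[ℝ] EuclideanSpace ℝ (Fin (2 * l)) :=
  Matrix.toEuclideanCLM (𝕜 := ℝ) A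

/-- The quadratic form `x ↦ ⟨A x, x⟩`. -/
def quadForm (A : Matrix (Fin (2 * l)) (Fin (2 * l)) ℝ) (x : EuclideanSpace ℝ (Fin (2 * l))) : ℝ :=
  ⟪act A x, x⟫

/-- The polynomial `F(x) = |x|⁴ - 2 ∑ ⟨P_α x, x⟩²`. -/
def fkmPoly (P : Fin (m + 1) → Matrix (Fin (2 * l)) (Fin (2 * l)) ℝ)
    (x : EuclideanSpace ℝ (Fin (2 * l))) : ℝ :=
  ‖x‖ ^ 4 - 2 * ∑ α, quadForm (P α) x ^ 2

/-- The unit sphere of `ℝ^(2l)`. -/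
def unitSphere (l : ℕ) : Set (EuclideanSpace ℝ (Fin (2 * l))) := Metric.sphere 0 1

/-- The level set `f⁻¹(c)` of the restriction `f` of `F` to the unit sphere. -/
def fkmLevel (P : Fin (m + 1) → Matrix (Fin (2 * l)) (Fin (2 * l)) ℝ) (c : ℝ) :
    Set (EuclideanSpace ℝ (Fin (2 * l))) :=
  {x | x ∈ unitSphere l ∧ fkmPoly P x = c}

/-- The focal submanifold `M₊ = f⁻¹(1)` of `f`. -/
def focalMPlus (P : Fin (m + 1) → Matrix (Fin (2 * l)) (Fin (2 * l)) ℝ) :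
    Set (EuclideanSpace ℝ (Fin (2 * l))) :=
  fkmLevel P 1

/-- The level set in `M` of the function `φ₂(x) = ⟨Q x, x⟩`. -/
def phiLevel (M : Set (EuclideanSpace ℝ (Fin (2 * l))))
    (Q : Matrix (Fin (2 * l)) (Fin (2 * l)) ℝ) (τ : ℝ) : Set (EuclideanSpace ℝ (Fin (2 * l))) :=
  {x | x ∈ M ∧ quadForm Q x = τ}

/-- The focal variety `N₊` of `φ₂(x) = ⟨Q x, x⟩` on `M`, where `φ₂` attains its maximum. -/
def focalNPlus (M : Set (EuclideanSpace ℝ (Fin (2 * l))))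
    (Q : Matrix (Fin (2 * l)) (Fin (2 * l)) ℝ) : Set (EuclideanSpace ℝ (Fin (2 * l))) :=
  {x | x ∈ M ∧ IsMaxOn (quadForm Q) M x}

/-- The focal variety `N₋` of `φ₂(x) = ⟨Q x, x⟩` on `M`, where `φ₂` attains its minimum. -/
def focalNMinus (M : Set (EuclideanSpace ℝ (Fin (2 * l))))
    (Q : Matrix (Fin (2 * l)) (Fin (2 * l)) ℝ) : Set (EuclideanSpace ℝ (Fin (2 * l))) :=
  {x | x ∈ M ∧ IsMinOn (quadForm Q) M x}

end Clifford

end FKM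

end

/-! A unit combination Q = ∑ a_α P_α is a symmetric involution. On M, Cauchy–Schwarz bounds ⟨Qx,x⟩²
by ∑ ⟨P_α x,x⟩² = (1-c)/2, with equality exactly when the vector (⟨P_α x,x⟩)_α is ±√((1-c)/2) · a.
Hence M₊, N₊ and N₋ are all common level sets of the forms ⟨P_α x,x⟩ on the sphere, with value
vectors of norm less than 1. There the P_α x are orthonormal and x lies outside their span, so the
level is regular of codimension m + 2 (`isSubmanifold_commonLevel`).

The relation Q P_α Q = 2 a_α Q - P_α shows that k + sQ with k² + s² = 1 sends the value vector 0 to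
2ks · a. Its linear inverse is (k - sQ)/(k² - s²). Taking k = cos t and s = ± sin t with sin 2t =
√((1-c)/2) gives the diffeomorphisms (`isDiffeomorphism_shear`). That the bound is attained follows
from M₊ being nonempty, a dimension count in the eigenspaces of P₀ (`focalMPlus_nonempty`).

For m = 1, a level set of φ₂ is locally a common level set of both forms. Rotate P₀, P₁ to R, T so
that Rx is normal to M and ⟨Tx,x⟩ = 0. The unit normal of the level set in M is then Tx, and the
second fundamental form along it is -⟨Tv,v⟩. Its trace vanishes: R conjugates T to -T, so T is
traceless, and the compression of T to the span of x, Rx, Tx is traceless too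
(`traceless_on_complement`). -/

namespace FKM

/-! ### Regular level sets, and derivatives along curves in them. -/

section Submanifolds

variable {E : Type*} [NormedAddCommGroup E] [InnerProductSpace ℝ E]

theorem IsSubmanifold.of_locally {d : ℕ} {S : Set E}
    (h : ∀ x ∈ S, ∃ (U Z : Set E), IsOpen U ∧ x ∈ U ∧ IsSubmanifold d Z ∧
      ∀ y ∈ U, y ∈ S ↔ y ∈ Z) : IsSubmanifold d S := by
  intro x hx
  obtain ⟨U, Z, hU, hxU, hZ, hSZ⟩ := h x hx
  obtain ⟨Φ, L, hL, hxΦ, h1, h2, h3⟩ := hZ x ((hSZ x hxU).1 hx)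
  refine ⟨Φ.restrOpen U hU, L, hL, ?_, ?_, ?_, ?_⟩
  · simpa using ⟨hxΦ, hxU⟩
  · refine ContDiffOn.mono h1 ?_
    simp
  · refine ContDiffOn.mono h2 ?_
    simp
  · intro y hy
    have hy' : y ∈ Φ.source ∧ y ∈ U := by simpa using hy
    rw [hSZ y hy'.2, h3 y hy'.1]
    simp

/-- The zero set of a smooth submersion is a submanifold. -/
theorem isSubmanifold_zeroSet [FiniteDimensional ℝ E]
    {F : Type*} [NormedAddCommGroup F] [NormedSpace ℝ F]
    [FiniteDimensional ℝ F] {G : E → F} (hG : ContDiff ℝ ∞ G)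
    (hsurj : ∀ x, G x = 0 → Function.Surjective (fderiv ℝ G x)) :
    IsSubmanifold (Module.finrank ℝ E - Module.finrank ℝ F) {x | G x = 0} := by
  intro x hx
  set D := fderiv ℝ G x with hD
  obtain ⟨A, hA⟩ := D.toLinearMap.exists_rightInverse_of_surjective
    (LinearMap.range_eq_top.2 (hsurj x hx))
  have hA' : ∀ w, D (A w) = w := fun w => LinearMap.congr_fun hA w
  set A' : F →L[ℝ] E := A.toContinuousLinearMap with hAdef
  have hA'' : ∀ w, D (A' w) = w := hA'
  -- D ∘ Ψ = G because A' is a right inverse of D, so Ψ carries the zero set of G into ker D; its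
  -- derivative at x is the identity.
  set Ψ : E → E := fun y => y + A' (G y - D y) with hΨ
  have hΨc : ContDiff ℝ ∞ Ψ :=
    contDiff_id.add (A'.contDiff.comp (hG.sub D.contDiff))
  have hΨD : HasFDerivAt Ψ ((ContinuousLinearEquiv.refl ℝ E : E ≃L[ℝ] E) : E →L[ℝ] E) x := by
    have hGx : HasFDerivAt G D x := (hG.differentiable (by simp) x).hasFDerivAt
    have := (hasFDerivAt_id (𝕜 := ℝ) x).add
      (A'.hasFDerivAt.comp x (hGx.sub D.hasFDerivAt))
    have h0 : ((ContinuousLinearEquiv.refl ℝ E : E ≃L[ℝ] E) : E →L[ℝ] E) =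
        ContinuousLinearMap.id ℝ E + A'.comp (D - D) := by
      ext v
      simp
    rw [h0]
    exact this
  set Φ := hΨc.contDiffAt.toOpenPartialHomeomorph Ψ hΨD (by simp) with hΦ
  -- The inverse is smooth at the image of any point where the derivative is invertible; restricting
  -- to this open set makes it smooth on the whole target.
  set U : Set E := {y | fderiv ℝ Ψ y ∈ Set.range
    ((↑) : (E ≃L[ℝ] E) → (E →L[ℝ] E))} with hUdef
  have hU : IsOpen U :=
    (ContinuousLinearEquiv.isOpen (𝕜 := ℝ) (E := E) (F := E)).preimage
      (hΨc.continuous_fderiv (by simp))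
  have hxU : x ∈ U := ⟨_, hΨD.fderiv.symm⟩
  have hΦc : (Φ : E → E) = Ψ := rfl
  refine ⟨Φ.restrOpen U hU, LinearMap.ker D.toLinearMap, ?_, ?_, ?_, ?_, ?_⟩
  · have := D.toLinearMap.finrank_range_add_finrank_ker
    rw [LinearMap.range_eq_top.2 (hsurj x hx), finrank_top] at this
    omega
  · have : x ∈ Φ.source := hΨc.contDiffAt.mem_toOpenPartialHomeomorph_source hΨD (by simp)
    simpa using ⟨this, hxU⟩
  · exact hΨc.contDiffOn
  · intro z hz
    apply ContDiffAt.contDiffWithinAt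
    have hz1 : z ∈ Φ.target := hz.1
    have hz2 : Φ.symm z ∈ U := hz.2
    obtain ⟨f, hf⟩ := hz2
    refine Φ.contDiffAt_symm hz1 (f₀' := f) ?_ hΨc.contDiffAt
    rw [hf]
    exact (hΨc.differentiable (by simp) _).hasFDerivAt
  · intro y _
    change G y = 0 ↔ D (Ψ y) = 0
    rw [hΨ]
    simp [hA'']

theorem IsDiffeomorphism.of_contDiff {h k : E → E} {A B : Set E} (hh : ContDiff ℝ ∞ h)
    (hk : ContDiff ℝ ∞ k) (hAB : Set.MapsTo h A B) (hBA : Set.MapsTo k B A)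
    (hinv : Set.InvOn k h A B) : IsDiffeomorphism h A B :=
  ⟨hAB, fun _ _ => ⟨Set.univ, h, isOpen_univ, trivial, hh.contDiffOn, fun _ _ => rfl⟩, k, hBA,
    fun _ _ => ⟨Set.univ, k, isOpen_univ, trivial, hk.contDiffOn, fun _ _ => rfl⟩, hinv⟩

theorem IsCurveIn.eventually_mem {S : Set E} {x : E} {γ : ℝ → E} (h : IsCurveIn S x γ) :
    ∀ᶠ t in 𝓝 (0 : ℝ), γ t ∈ S := by
  obtain ⟨_, ε, hε, _, hS⟩ := h
  filter_upwards [Ioo_mem_nhds (neg_lt_zero.2 hε) hε] with t ht using hS t ht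

theorem IsCurveIn.contDiffAt {S : Set E} {x : E} {γ : ℝ → E} (h : IsCurveIn S x γ) :
    ContDiffAt ℝ ∞ γ 0 := by
  obtain ⟨_, ε, hε, hγ, _⟩ := h
  exact hγ.contDiffAt (Ioo_mem_nhds (neg_lt_zero.2 hε) hε)

theorem IsCurveIn.hasDerivAt {S : Set E} {x : E} {γ : ℝ → E} (h : IsCurveIn S x γ) :
    HasDerivAt γ (deriv γ 0) 0 :=
  (h.contDiffAt.differentiableAt (by simp)).hasDerivAt

theorem IsCurveIn.eventually_hasDerivAt {S : Set E} {x : E} {γ : ℝ → E} (h : IsCurveIn S x γ) :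
    ∀ᶠ t in 𝓝 (0 : ℝ), HasDerivAt γ (deriv γ t) t := by
  have h1 : ContDiffAt ℝ 1 γ 0 := by
    simpa using contDiffAt_infty.1 h.contDiffAt 1
  filter_upwards [h1.eventually (by simp)] with t ht
  exact (ht.differentiableAt (by simp)).hasDerivAt

theorem IsCurveIn.hasDerivAt_deriv {S : Set E} {x : E} {γ : ℝ → E} (h : IsCurveIn S x γ) :
    HasDerivAt (deriv γ) (deriv (deriv γ) 0) 0 := by
  have h2 : ContDiffAt ℝ (1 + 1) γ 0 := by
    simpa [one_add_one_eq_two] using contDiffAt_infty.1 h.contDiffAt 2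
  have : ContDiffAt ℝ 1 (deriv γ) 0 := by
    have := h2.fderiv_right (m := 1) le_rfl
    have h3 := this.clm_apply (contDiffAt_const (c := (1 : ℝ)))
    exact h3
  exact (this.differentiableAt (by simp)).hasDerivAt

theorem tangentSpaceAt_le_orthogonal {S : Set E} {x w : E}
    (h : ∀ γ, IsCurveIn S x γ → ⟪w, deriv γ 0⟫ = 0) {v : E} (hv : v ∈ tangentSpaceAt S x) :
    ⟪w, v⟫ = 0 := by
  have : tangentSpaceAt S x ≤ LinearMap.ker (innerₛₗ ℝ w) := by
    refine Submodule.span_le.2 ?_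
    rintro _ ⟨γ, hγ, rfl⟩
    simpa using h γ hγ
  simpa using this hv

theorem hasDerivAt_inner_self_symm {T : E →L[ℝ] E} (hT : ∀ x y : E, ⟪T x, y⟫ = ⟪x, T y⟫)
    {γ : ℝ → E} {v : E} {t : ℝ} (h : HasDerivAt γ v t) :
    HasDerivAt (fun s => ⟪T (γ s), γ s⟫) (2 * ⟪T (γ t), v⟫) t := by
  have := (T.hasFDerivAt.comp_hasDerivAt t h).inner ℝ h
  refine this.congr_deriv ?_
  rw [hT v, real_inner_comm _ v, Function.comp_apply]
  ring

/-- First and second order consequences of a quadratic form being constant along a curve. -/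
theorem IsCurveIn.inner_eq_zero_of_const {S : Set E} {T : E →L[ℝ] E}
    (hT : ∀ x y : E, ⟪T x, y⟫ = ⟪x, T y⟫) {x : E} {γ : ℝ → E} (h : IsCurveIn S x γ) {b : ℝ}
    (hb : ∀ᶠ t in 𝓝 (0 : ℝ), ⟪T (γ t), γ t⟫ = b) :
    ⟪T x, deriv γ 0⟫ = 0 ∧ ⟪T x, deriv (deriv γ) 0⟫ = - ⟪T (deriv γ 0), deriv γ 0⟫ := by
  -- The first-order identity is needed on a neighbourhood of 0, so that it can be differentiated
  -- once more.
  have key : ∀ᶠ t in 𝓝 (0 : ℝ), ⟪T (γ t), deriv γ t⟫ = 0 := by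
    filter_upwards [hb.eventually_nhds, h.eventually_hasDerivAt] with t ht hd
    have h1 := hasDerivAt_inner_self_symm hT hd
    have h2 : HasDerivAt (fun s => ⟪T (γ s), γ s⟫) 0 t :=
      (hasDerivAt_const t b).congr_of_eventuallyEq ht
    have := h1.unique h2
    linarith
  refine ⟨by simpa [h.1] using key.self_of_nhds, ?_⟩
  have h1 := (T.hasFDerivAt.comp_hasDerivAt 0 h.hasDerivAt).inner ℝ h.hasDerivAt_deriv
  have h2 := (hasDerivAt_const (0 : ℝ) (0 : ℝ)).congr_of_eventuallyEq key
  have := h1.unique h2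
  simp only [Function.comp_apply, h.1] at this
  linarith

end Submanifolds

/-! ### Clifford systems: regular common levels and nonemptiness of M₊. -/

section Clifford

variable {l m : ℕ}

theorem act_add (A B : Matrix (Fin (2 * l)) (Fin (2 * l)) ℝ) : act (A + B) = act A + act B :=
  map_add _ A B

theorem act_smul (r : ℝ) (A : Matrix (Fin (2 * l)) (Fin (2 * l)) ℝ) : act (r • A) = r • act A :=
  map_smul (Matrix.toEuclideanCLM (n := Fin (2 * l)) (𝕜 := ℝ)) r A

theorem act_sum {ι : Type*} (s : Finset ι) (A : ι → Matrix (Fin (2 * l)) (Fin (2 * l)) ℝ) :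
    act (∑ i ∈ s, A i) = ∑ i ∈ s, act (A i) :=
  map_sum (Matrix.toEuclideanCLM (n := Fin (2 * l)) (𝕜 := ℝ)) A s

theorem act_mul_apply (A B : Matrix (Fin (2 * l)) (Fin (2 * l)) ℝ)
    (x : EuclideanSpace ℝ (Fin (2 * l))) : act (A * B) x = act A (act B x) := by
  have : act (A * B) = act A * act B :=
    map_mul (Matrix.toEuclideanCLM (n := Fin (2 * l)) (𝕜 := ℝ)) A B
  rw [this]
  rfl

theorem act_one : act (1 : Matrix (Fin (2 * l)) (Fin (2 * l)) ℝ) = 1 :=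
  map_one (Matrix.toEuclideanCLM (n := Fin (2 * l)) (𝕜 := ℝ))

theorem inner_act_left {A : Matrix (Fin (2 * l)) (Fin (2 * l)) ℝ} (hA : A.IsSymm)
    (x y : EuclideanSpace ℝ (Fin (2 * l))) : ⟪act A x, y⟫ = ⟪x, act A y⟫ := by
  have h : star (act A) = act (star A) :=
    ((Matrix.toEuclideanCLM (n := Fin (2 * l)) (𝕜 := ℝ)).map_star' A).symm
  have h2 : star A = A := by
    rw [Matrix.star_eq_conjTranspose, Matrix.conjTranspose_eq_transpose_of_trivial]
    exact hA
  rw [h2, ContinuousLinearMap.star_eq_adjoint] at h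
  rw [← ContinuousLinearMap.adjoint_inner_right, h]

theorem quadForm_sum_smul (P : Fin (m + 1) → Matrix (Fin (2 * l)) (Fin (2 * l)) ℝ)
    (a : Fin (m + 1) → ℝ) (x : EuclideanSpace ℝ (Fin (2 * l))) :
    quadForm (∑ α, a α • P α) x = ∑ α, a α * quadForm (P α) x := by
  simp [quadForm, act_sum, act_smul, sum_inner, inner_smul_left]

theorem contDiff_quadForm (A : Matrix (Fin (2 * l)) (Fin (2 * l)) ℝ) :
    ContDiff ℝ ∞ (quadForm A) :=
  (act A).contDiff.inner ℝ contDiff_id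

theorem hasFDerivAt_quadForm {A : Matrix (Fin (2 * l)) (Fin (2 * l)) ℝ} (hA : A.IsSymm)
    (x : EuclideanSpace ℝ (Fin (2 * l))) :
    HasFDerivAt (quadForm A) ((2 : ℝ) • innerSL ℝ (act A x)) x := by
  have := (act A).hasFDerivAt.inner ℝ (hasFDerivAt_id (𝕜 := ℝ) x)
  refine this.congr_fderiv ?_
  ext v
  simp [inner_act_left hA v, real_inner_comm _ v]
  ring

theorem mem_fkmLevel_iff (P : Fin (m + 1) → Matrix (Fin (2 * l)) (Fin (2 * l)) ℝ)
    (c : ℝ) (x : EuclideanSpace ℝ (Fin (2 * l))) :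
    x ∈ fkmLevel P c ↔ ‖x‖ = 1 ∧ ∑ α, quadForm (P α) x ^ 2 = (1 - c) / 2 := by
  simp only [fkmLevel, unitSphere, Set.mem_ofPred_eq, mem_sphere_zero_iff_norm, fkmPoly]
  refine and_congr_right fun h => ?_
  rw [h]
  constructor <;> intro h <;> linarith

theorem focalMPlus_eq (P : Fin (m + 1) → Matrix (Fin (2 * l)) (Fin (2 * l)) ℝ) :
    focalMPlus P = {x | x ∈ unitSphere l ∧ ∀ α, quadForm (P α) x = 0} := by
  ext x
  rw [focalMPlus, mem_fkmLevel_iff]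
  simp only [unitSphere, Set.mem_ofPred_eq, mem_sphere_zero_iff_norm]
  refine and_congr_right fun _ => ?_
  rw [show ((1 : ℝ) - 1) / 2 = 0 by norm_num, Finset.sum_eq_zero_iff_of_nonneg
    fun _ _ => sq_nonneg _]
  simp

theorem mem_focalMPlus_iff (P : Fin (m + 1) → Matrix (Fin (2 * l)) (Fin (2 * l)) ℝ)
    (x : EuclideanSpace ℝ (Fin (2 * l))) :
    x ∈ focalMPlus P ↔ ‖x‖ = 1 ∧ ∀ α, quadForm (P α) x = 0 := by
  rw [focalMPlus_eq]
  simp [unitSphere]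

namespace IsCliffordSystem

variable {P : Fin (m + 1) → Matrix (Fin (2 * l)) (Fin (2 * l)) ℝ} (hP : IsCliffordSystem P)
include hP

theorem act_anticomm (i j : Fin (m + 1)) (x : EuclideanSpace ℝ (Fin (2 * l))) :
    act (P i) (act (P j) x) + act (P j) (act (P i) x) = if i = j then (2 : ℝ) • x else 0 := by
  have := congrArg (fun A => act A x) (hP.anticomm i j)
  simp only [act_add, act_mul_apply, add_apply] at this
  rw [this]
  split_ifs
  · simp [act_smul, act_one]
  · rw [show act (0 : Matrix (Fin (2 * l)) (Fin (2 * l)) ℝ) = 0 from map_zero _]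
    rfl

theorem act_act (i : Fin (m + 1)) (x : EuclideanSpace ℝ (Fin (2 * l))) :
    act (P i) (act (P i) x) = x := by
  have := hP.act_anticomm i i x
  rw [if_pos rfl, ← two_smul ℝ] at this
  exact smul_right_injective _ (two_ne_zero' ℝ) this

theorem act_act_of_ne {i j : Fin (m + 1)} (h : i ≠ j) (x : EuclideanSpace ℝ (Fin (2 * l))) :
    act (P i) (act (P j) x) = - act (P j) (act (P i) x) := by
  have := hP.act_anticomm i j x
  rw [if_neg h] at this
  exact eq_neg_of_add_eq_zero_left this

theorem inner_act_act (i j : Fin (m + 1)) (x : EuclideanSpace ℝ (Fin (2 * l))) :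
    ⟪act (P i) x, act (P j) x⟫ = if i = j then ‖x‖ ^ 2 else 0 := by
  have h := congrArg (fun y => ⟪x, y⟫) (hP.act_anticomm i j x)
  simp only [inner_add_right] at h
  rw [← inner_act_left (hP.symm i) x, ← inner_act_left (hP.symm j) x,
    real_inner_comm (act (P i) x) (act (P j) x)] at h
  split_ifs at h ⊢
  · rw [inner_smul_right, real_inner_self_eq_norm_sq] at h
    linarith
  · rw [inner_zero_right] at h
    linarith

/-- The common level sets of the quadratic forms of a Clifford system on the unit sphere are
submanifolds, as long as the values lie in the open unit ball. -/
theorem isSubmanifold_commonLevel {b : Fin (m + 1) → ℝ} (hb : ∑ α, b α ^ 2 < 1) :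
    IsSubmanifold (2 * l - 2 - m)
      {x : EuclideanSpace ℝ (Fin (2 * l)) | ‖x‖ = 1 ∧ ∀ α, quadForm (P α) x = b α} := by
  set G : EuclideanSpace ℝ (Fin (2 * l)) → ℝ × (Fin (m + 1) → ℝ) :=
    fun y => (⟪y, y⟫ - 1, fun α => quadForm (P α) y - b α) with hG
  have hGc : ContDiff ℝ ∞ G :=
    ((contDiff_id.inner ℝ contDiff_id).sub contDiff_const).prodMk
      (contDiff_pi.2 fun α => (contDiff_quadForm (P α)).sub contDiff_const)
  have hset : {x : EuclideanSpace ℝ (Fin (2 * l)) | ‖x‖ = 1 ∧ ∀ α, quadForm (P α) x = b α} =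
      {x | G x = 0} := by
    ext x
    simp only [hG, Set.mem_ofPred_eq, Prod.mk_eq_zero, funext_iff, Pi.zero_apply, sub_eq_zero,
      real_inner_self_eq_norm_sq]
    refine and_congr_left fun _ => ?_
    exact (pow_eq_one_iff_of_nonneg (norm_nonneg x) two_ne_zero).symm
  have hsurj : ∀ x, G x = 0 → Function.Surjective (fderiv ℝ G x) := by
    intro x hx
    have hx' : x ∈ {x : EuclideanSpace ℝ (Fin (2 * l)) | ‖x‖ = 1 ∧
      ∀ α, quadForm (P α) x = b α} := hset ▸ hx
    obtain ⟨hx1, hxb⟩ := hx'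
    have hd : HasFDerivAt G (((2 : ℝ) • innerSL ℝ x).prod
        (ContinuousLinearMap.pi fun α => (2 : ℝ) • innerSL ℝ (act (P α) x))) x := by
      refine HasFDerivAt.prodMk ?_ (hasFDerivAt_pi.2 fun α =>
        (hasFDerivAt_quadForm (hP.symm α) x).sub_const _)
      refine (((hasFDerivAt_id (𝕜 := ℝ) x).inner ℝ (hasFDerivAt_id x)).sub_const _).congr_fderiv ?_
      ext v
      simp [real_inner_comm x v]
      ring
    rw [hd.fderiv]
    rintro ⟨s, r⟩
    set q := ∑ α, b α ^ 2 with hq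
    -- Solves the Gram system of x and the P_β x. Orthonormality of the P_β x fixes their
    -- coefficients as r_β - μ b_β; pairing with x leaves μ(1 - q) + ∑ b_β r_β = s. The factor 1/2
    -- in the witness cancels the 2 in the derivatives.
    set μ := (s - ∑ α, b α * r α) / (1 - q) with hμ
    have hμq : μ * (1 - q) = s - ∑ α, b α * r α := div_mul_cancel₀ _ (by linarith)
    have hbx : ∀ α, ⟪x, act (P α) x⟫ = b α := fun α => by
      rw [real_inner_comm]
      exact hxb α
    refine ⟨(1 / 2 : ℝ) • (μ • x + ∑ β, (r β - μ * b β) • act (P β) x), ?_⟩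
    ext α
    · have : ∑ β, (r β - μ * b β) * b β = (∑ β, b β * r β) - μ * q := by
        rw [hq, Finset.mul_sum, ← Finset.sum_sub_distrib]
        exact Finset.sum_congr rfl fun β _ => by ring
      simp only [ContinuousLinearMap.prod_apply, smul_apply, innerSL_apply_apply,
        inner_smul_right, inner_add_right, inner_sum, hbx, smul_eq_mul, this,
        real_inner_self_eq_norm_sq, hx1]
      linarith
    · have : ⟪act (P α) x, x⟫ = b α := hxb α
      simp only [ContinuousLinearMap.prod_apply, smul_apply, innerSL_apply_apply,
        inner_smul_right, inner_add_right, inner_sum, smul_eq_mul, ContinuousLinearMap.pi_apply,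
        hP.inner_act_act, hx1, this]
      simp
  have := isSubmanifold_zeroSet hGc hsurj
  rw [← hset] at this
  convert this using 1
  simp
  omega

theorem isSubmanifold_focalMPlus : IsSubmanifold (2 * l - 2 - m) (focalMPlus P) := by
  have : focalMPlus P = {x | ‖x‖ = 1 ∧ ∀ α, quadForm (P α) x = 0} :=
    Set.ext (mem_focalMPlus_iff P)
  rw [this]
  exact hP.isSubmanifold_commonLevel (b := fun _ => 0) (by simp)

/-- The `-1`-eigenspace of `P₀` has at least half the dimension. -/
theorem le_finrank_eigenspace (hm : 1 ≤ m) :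
    l ≤ Module.finrank ℝ (LinearMap.ker (act (P 0) + 1 : EuclideanSpace ℝ (Fin (2 * l)) →L[ℝ]
      EuclideanSpace ℝ (Fin (2 * l))).toLinearMap) := by
  set T := (act (P 0) + 1 : EuclideanSpace ℝ (Fin (2 * l)) →L[ℝ]
      EuclideanSpace ℝ (Fin (2 * l))).toLinearMap with hT
  have hT' : ∀ x, T x = act (P 0) x + x := fun x => rfl
  set i : Fin (m + 1) := ⟨1, by omega⟩ with hi
  have h0i : (0 : Fin (m + 1)) ≠ i := by
    simp [hi, Fin.ext_iff]
  have hinj : Function.Injective (act (P i)).toLinearMap := fun x y h => by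
    have := congrArg (act (P i)) h
    simpa only [ContinuousLinearMap.coe_coe, hP.act_act] using this
  -- The range of P₀ + 1 consists of +1-eigenvectors, and P_i anticommutes with P₀, so it moves them
  -- injectively into the -1-eigenspace. Thus rank ≤ nullity.
  have hle : (LinearMap.range T).map (act (P i)).toLinearMap ≤ LinearMap.ker T := by
    rintro _ ⟨_, ⟨y, rfl⟩, rfl⟩
    change act (P 0) (act (P i) (act (P 0) y + y)) + act (P i) (act (P 0) y + y) = 0
    rw [map_add, map_add,
      hP.act_act_of_ne h0i, hP.act_act_of_ne h0i, hP.act_act]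
    abel
  have h1 := Submodule.finrank_mono hle
  rw [← (Submodule.equivMapOfInjective _ hinj (LinearMap.range T)).finrank_eq] at h1
  have h2 := T.finrank_range_add_finrank_ker
  rw [finrank_euclideanSpace_fin] at h2
  omega

/-- For α ≥ 1 the form of P_α vanishes on each eigenspace of P₀. For u, v of equal norm in the +1-
and -1-eigenspaces, all forms vanish at u + v once ⟨P_α u,v⟩ = 0 for α ≥ 1. These are m linear
conditions on v in a space of dimension at least l > m. -/
theorem focalMPlus_nonempty (hm : 1 ≤ m) (hl : m + 1 < l) : (focalMPlus P).Nonempty := by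
  set i : Fin (m + 1) := ⟨1, by omega⟩ with hi
  have h0i : (0 : Fin (m + 1)) ≠ i := by
    simp [hi, Fin.ext_iff]
  set K := LinearMap.ker (act (P 0) + 1 : EuclideanSpace ℝ (Fin (2 * l)) →L[ℝ]
      EuclideanSpace ℝ (Fin (2 * l))).toLinearMap with hK
  have hKl : l ≤ Module.finrank ℝ K := hP.le_finrank_eigenspace hm
  have hKmem : ∀ v ∈ K, act (P 0) v = -v := fun v hv => eq_neg_of_add_eq_zero_left hv
  obtain ⟨w, hw⟩ : ∃ w : K, w ≠ 0 :=
    @exists_ne _ (Module.nontrivial_of_finrank_pos (R := ℝ) (M := K) (by omega)) 0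
  set u := act (P i) (w : EuclideanSpace ℝ (Fin (2 * l))) with hu
  have hu0 : act (P 0) u = u := by
    rw [hu, hP.act_act_of_ne h0i, hKmem w w.2, map_neg, neg_neg]
  have hune : u ≠ 0 := by
    intro h
    apply hw
    ext1
    rw [← hP.act_act i (w : EuclideanSpace ℝ (Fin (2 * l))), ← hu, h, map_zero]
    rfl
  set Λ : K →ₗ[ℝ] (Fin m → ℝ) :=
    (LinearMap.pi fun α : Fin m => innerₛₗ ℝ (act (P α.succ) u)) ∘ₗ K.subtype with hΛ
  obtain ⟨v, hv, hv0⟩ := Submodule.exists_mem_ne_zero_of_ne_bot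
    (LinearMap.ker_ne_bot_of_finrank_lt (f := Λ) (by
      rw [Module.finrank_fin_fun]
      omega))
  have hv1 : act (P 0) (v : EuclideanSpace ℝ (Fin (2 * l))) = -v := hKmem v v.2
  have hΛv : ∀ α : Fin m, ⟪act (P α.succ) u, (v : EuclideanSpace ℝ (Fin (2 * l)))⟫ = 0 :=
    fun α => congrFun hv α
  have hvn : ‖(v : EuclideanSpace ℝ (Fin (2 * l)))‖ ≠ 0 := by
    simpa using hv0
  have hun : ‖u‖ ≠ 0 := norm_ne_zero_iff.2 hune
  have horth : ⟪u, (v : EuclideanSpace ℝ (Fin (2 * l)))⟫ = 0 := by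
    have := inner_act_left (hP.symm 0) u (v : EuclideanSpace ℝ (Fin (2 * l)))
    rw [hu0, hv1, inner_neg_right] at this
    linarith
  -- Evaluating ⟨P_α P₀ y,y⟩ directly and after anticommuting gives opposite values.
  have hself : ∀ (α : Fin m) (y : EuclideanSpace ℝ (Fin (2 * l))) (s : ℝ), s ≠ 0 →
      act (P 0) y = s • y → ⟪act (P α.succ) y, y⟫ = 0 := by
    intro α y s hs hy
    have h1 : ⟪act (P α.succ) (act (P 0) y), y⟫ = s * ⟪act (P α.succ) y, y⟫ := by
      rw [hy, map_smul, inner_smul_left]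
      rfl
    have h2 : ⟪act (P α.succ) (act (P 0) y), y⟫ = -(s * ⟪act (P α.succ) y, y⟫) := by
      rw [hP.act_act_of_ne (Fin.succ_ne_zero α), inner_neg_left, inner_act_left (hP.symm 0), hy,
        inner_smul_right]
    have : s * ⟪act (P α.succ) y, y⟫ = 0 := by linarith
    simpa [hs] using this
  have huα : ∀ α : Fin m, ⟪act (P α.succ) u, u⟫ = 0 := fun α =>
    hself α u 1 one_ne_zero (by rw [hu0, one_smul])
  have hvα : ∀ α : Fin m, ⟪act (P α.succ) (v : EuclideanSpace ℝ (Fin (2 * l))), v⟫ = 0 :=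
    fun α => hself α v (-1) (by norm_num) (by rw [hv1, neg_one_smul])
  have hvu : ∀ α : Fin m, ⟪act (P α.succ) (v : EuclideanSpace ℝ (Fin (2 * l))), u⟫ = 0 :=
    fun α => by rw [inner_act_left (hP.symm _), real_inner_comm, hΛv]
  -- The weights equalise the norms of the two summands, which makes the form of P₀ cancel.
  set z := ‖(v : EuclideanSpace ℝ (Fin (2 * l)))‖ • u +
    ‖u‖ • (v : EuclideanSpace ℝ (Fin (2 * l))) with hz
  have hzz : ⟪z, z⟫ = 2 * (‖u‖ * ‖(v : EuclideanSpace ℝ (Fin (2 * l)))‖) ^ 2 := by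
    simp only [hz, inner_add_left, inner_add_right, inner_smul_left, inner_smul_right, horth,
      real_inner_comm u (v : EuclideanSpace ℝ (Fin (2 * l))), real_inner_self_eq_norm_sq,
      RCLike.conj_to_real]
    ring
  have hzq : ∀ α, quadForm (P α) z = 0 := by
    intro α
    refine Fin.cases ?_ (fun α => ?_) α
    · simp only [quadForm, hz, map_add, map_smul, hu0, hv1, inner_add_left, inner_add_right,
        inner_smul_left, inner_smul_right, horth, inner_neg_left,
        real_inner_comm u (v : EuclideanSpace ℝ (Fin (2 * l))), real_inner_self_eq_norm_sq,
        RCLike.conj_to_real]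
      ring
    · simp only [quadForm, hz, map_add, map_smul, inner_add_left, inner_add_right,
        inner_smul_left, inner_smul_right, huα, hvα, hvu, hΛv]
      ring
  have hzn : ‖z‖ ≠ 0 := by
    intro h
    rw [real_inner_self_eq_norm_sq, h] at hzz
    have : (‖u‖ * ‖(v : EuclideanSpace ℝ (Fin (2 * l)))‖) ^ 2 ≠ 0 :=
      pow_ne_zero _ (mul_ne_zero hun hvn)
    apply this
    linarith
  refine ⟨‖z‖⁻¹ • z, (mem_focalMPlus_iff P _).2 ⟨?_, fun α => ?_⟩⟩
  · rw [norm_smul, norm_inv, norm_norm, inv_mul_cancel₀ hzn]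
  · have : quadForm (P α) (‖z‖⁻¹ • z) = ‖z‖⁻¹ * (‖z‖⁻¹ * quadForm (P α) z) := by
      simp only [quadForm, map_smul, inner_smul_left, inner_smul_right, RCLike.conj_to_real]
    rw [this, hzq α, mul_zero, mul_zero]

end IsCliffordSystem
end Clifford

/-! ### The Clifford sphere and extremal levels of φ₂. -/

section Clifford

variable {l m : ℕ}

namespace IsCliffordSystem

variable {P : Fin (m + 1) → Matrix (Fin (2 * l)) (Fin (2 * l)) ℝ} (hP : IsCliffordSystem P)
include hP

theorem isSymm_sum_smul (a : Fin (m + 1) → ℝ) : (∑ α, a α • P α).IsSymm := by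
  rw [Matrix.IsSymm, Matrix.transpose_sum]
  exact Finset.sum_congr rfl fun α _ => by rw [Matrix.transpose_smul, hP.symm α]

theorem act_anticomm_sum_smul (α : Fin (m + 1)) (a : Fin (m + 1) → ℝ)
    (x : EuclideanSpace ℝ (Fin (2 * l))) :
    act (P α) (act (∑ β, a β • P β) x) + act (∑ β, a β • P β) (act (P α) x) =
      (2 * a α) • x := by
  have : ∀ y, act (∑ β, a β • P β) y = ∑ β, a β • act (P β) y := fun y => by
    simp [act_sum, act_smul]
  rw [this, this, map_sum, ← Finset.sum_add_distrib]
  simp only [map_smul, ← smul_add, hP.act_anticomm, smul_ite, smul_zero]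
  simp [smul_smul, mul_comm]

theorem act_sum_smul_anticomm (a b : Fin (m + 1) → ℝ) (x : EuclideanSpace ℝ (Fin (2 * l))) :
    act (∑ α, a α • P α) (act (∑ α, b α • P α) x) +
      act (∑ α, b α • P α) (act (∑ α, a α • P α) x) = (2 * ∑ α, a α * b α) • x := by
  have : ∀ y, act (∑ α, a α • P α) y = ∑ α, a α • act (P α) y := fun y => by
    simp [act_sum, act_smul]
  rw [this, this, map_sum, ← Finset.sum_add_distrib, Finset.mul_sum, Finset.sum_smul]
  refine Finset.sum_congr rfl fun α _ => ?_
  rw [map_smul, ← smul_add, hP.act_anticomm_sum_smul, smul_smul]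
  congr 1
  ring

theorem act_sum_smul_involutive {a : Fin (m + 1) → ℝ} (ha : ∑ α, a α ^ 2 = 1)
    (x : EuclideanSpace ℝ (Fin (2 * l))) :
    act (∑ α, a α • P α) (act (∑ α, a α • P α) x) = x := by
  have h := hP.act_sum_smul_anticomm a a x
  simp only [← pow_two, ha, mul_one, ← two_smul ℝ (act (∑ α, a α • P α) _)] at h
  exact smul_right_injective _ (two_ne_zero' ℝ) h

theorem norm_sq_smul_add_smul {a : Fin (m + 1) → ℝ} (ha : ∑ α, a α ^ 2 = 1) (k s : ℝ)
    (x : EuclideanSpace ℝ (Fin (2 * l))) :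
    ‖k • x + s • act (∑ α, a α • P α) x‖ ^ 2 =
      (k ^ 2 + s ^ 2) * ‖x‖ ^ 2 + 2 * k * s * quadForm (∑ α, a α • P α) x := by
  have h1 : ⟪act (∑ α, a α • P α) x, act (∑ α, a α • P α) x⟫ = ‖x‖ ^ 2 := by
    rw [inner_act_left (hP.isSymm_sum_smul a), hP.act_sum_smul_involutive ha,
      real_inner_self_eq_norm_sq]
  rw [← real_inner_self_eq_norm_sq (k • x + _)]
  simp only [inner_add_left, inner_add_right, inner_smul_left, inner_smul_right, h1,
    RCLike.conj_to_real, quadForm, real_inner_self_eq_norm_sq,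
    real_inner_comm (act (∑ α, a α • P α) x) x]
  ring

/-- Rests on Q P_α Q = 2 a_α Q - P_α, which follows from P_α Q + Q P_α = 2 a_α and Q² = 1. -/
theorem quadForm_smul_add_smul {a : Fin (m + 1) → ℝ} (ha : ∑ α, a α ^ 2 = 1) (k s : ℝ)
    (α : Fin (m + 1)) (x : EuclideanSpace ℝ (Fin (2 * l))) :
    quadForm (P α) (k • x + s • act (∑ α, a α • P α) x) =
      (k ^ 2 - s ^ 2) * quadForm (P α) x + 2 * k * s * a α * ‖x‖ ^ 2 +
        2 * s ^ 2 * a α * quadForm (∑ α, a α • P α) x := by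
  set T := act (∑ α, a α • P α) with hT
  have hTs : ∀ x y, ⟪T x, y⟫ = ⟪x, T y⟫ := inner_act_left (hP.isSymm_sum_smul a)
  have h0 : act (P α) (T x) + T (act (P α) x) = (2 * a α) • x := hP.act_anticomm_sum_smul α a x
  have h1 : ⟪act (P α) (T x), x⟫ + ⟪act (P α) x, T x⟫ = 2 * a α * ‖x‖ ^ 2 := by
    rw [← hTs (act (P α) x), ← inner_add_left, h0, inner_smul_left, real_inner_self_eq_norm_sq]
    rfl
  have h2 : ⟪act (P α) (T x), T x⟫ = 2 * a α * ⟪T x, x⟫ - ⟪act (P α) x, x⟫ := by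
    rw [eq_sub_of_add_eq h0, inner_sub_left, inner_smul_left, hTs (act (P α) x),
      hP.act_sum_smul_involutive ha, real_inner_comm x (T x)]
    rfl
  have h3 : ⟪act (P α) (k • x + s • T x), k • x + s • T x⟫ = k ^ 2 * ⟪act (P α) x, x⟫ +
      k * s * (⟪act (P α) (T x), x⟫ + ⟪act (P α) x, T x⟫) + s ^ 2 * ⟪act (P α) (T x), T x⟫ := by
    simp only [map_add, map_smul, inner_add_left, inner_add_right, inner_smul_left,
      inner_smul_right, RCLike.conj_to_real]
    ring
  rw [h1, h2] at h3
  simp only [quadForm, ← hT]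
  rw [h3]
  ring

omit hP in
-- The equality case of Cauchy–Schwarz: ∑ (⟨P_α x,x⟩ - r a_α)² expands to r² - 2r² + r² = 0. The
-- sign of r is free, so both extremal levels are covered.
theorem mem_phiLevel_iff {a : Fin (m + 1) → ℝ} (ha : ∑ α, a α ^ 2 = 1) {c r : ℝ}
    (hr : r ^ 2 = (1 - c) / 2) (x : EuclideanSpace ℝ (Fin (2 * l))) :
    x ∈ phiLevel (fkmLevel P c) (∑ α, a α • P α) r ↔
      ‖x‖ = 1 ∧ ∀ α, quadForm (P α) x = r * a α := by
  simp only [phiLevel, Set.mem_ofPred_eq, mem_fkmLevel_iff, quadForm_sum_smul, and_assoc, ← hr]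
  refine and_congr_right fun _ => ⟨fun ⟨h1, h2⟩ => ?_, fun h => ?_⟩
  · have h : ∑ α, (quadForm (P α) x - r * a α) ^ 2 = 0 := by
      have : ∑ α, (quadForm (P α) x - r * a α) ^ 2 = ∑ α, quadForm (P α) x ^ 2 -
          2 * r * ∑ α, a α * quadForm (P α) x + r ^ 2 * ∑ α, a α ^ 2 := by
        rw [Finset.mul_sum, Finset.mul_sum, ← Finset.sum_sub_distrib, ← Finset.sum_add_distrib]
        exact Finset.sum_congr rfl fun _ _ => by ring
      rw [this, h1, h2, ha]
      ring
    intro α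
    have := (Finset.sum_eq_zero_iff_of_nonneg fun _ _ => sq_nonneg _).1 h α (Finset.mem_univ α)
    exact sub_eq_zero.1 (pow_eq_zero_iff two_ne_zero |>.1 this)
  · simp only [h]
    constructor
    · simp only [mul_pow, ← Finset.mul_sum, ha, mul_one]
    · have : ∑ α, a α * (r * a α) = r * ∑ α, a α ^ 2 := by
        rw [Finset.mul_sum]
        exact Finset.sum_congr rfl fun _ _ => by ring
      rw [this, ha, mul_one]

theorem isSubmanifold_phiLevel {a : Fin (m + 1) → ℝ} (ha : ∑ α, a α ^ 2 = 1) {c r : ℝ}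
    (hr : r ^ 2 = (1 - c) / 2) (hc : -1 < c) :
    IsSubmanifold (2 * l - 2 - m) (phiLevel (fkmLevel P c) (∑ α, a α • P α) r) := by
  rw [Set.ext (mem_phiLevel_iff (P := P) ha hr)]
  refine hP.isSubmanifold_commonLevel ?_
  simp only [mul_pow, ← Finset.mul_sum, ha, mul_one]
  linarith

/-! ### The maps k + sQ between M₊ and the extremal levels. -/

section Shear

variable {a : Fin (m + 1) → ℝ} {c k s : ℝ}

theorem mapsTo_shear (ha : ∑ α, a α ^ 2 = 1) (hks : k ^ 2 + s ^ 2 = 1)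
    (hc : (2 * k * s) ^ 2 = (1 - c) / 2) :
    Set.MapsTo (fun x => k • x + s • act (∑ α, a α • P α) x) (focalMPlus P)
      (phiLevel (fkmLevel P c) (∑ α, a α • P α) (2 * k * s)) := by
  intro x hx
  obtain ⟨hx1, hx0⟩ := (mem_focalMPlus_iff P x).1 hx
  have hq : quadForm (∑ α, a α • P α) x = 0 := by
    simp [quadForm_sum_smul, hx0]
  refine (mem_phiLevel_iff ha hc _).2 ⟨?_, fun α => ?_⟩
  · refine (pow_eq_one_iff_of_nonneg (norm_nonneg _) two_ne_zero).1 ?_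
    rw [hP.norm_sq_smul_add_smul ha, hq, hx1, hks]
    ring
  · rw [hP.quadForm_smul_add_smul ha, hq, hx1, hx0]
    ring

/-- The map is the inverse of k + sQ, since (k + sQ)(k - sQ) = k² - s². -/
theorem mapsTo_unshear (ha : ∑ α, a α ^ 2 = 1) (hks : k ^ 2 + s ^ 2 = 1)
    (hks' : k ^ 2 - s ^ 2 ≠ 0) (hc : (2 * k * s) ^ 2 = (1 - c) / 2) :
    Set.MapsTo (fun x => (k ^ 2 - s ^ 2)⁻¹ • (k • x + (-s) • act (∑ α, a α • P α) x))
      (phiLevel (fkmLevel P c) (∑ α, a α • P α) (2 * k * s)) (focalMPlus P) := by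
  intro x hx
  have hq : quadForm (∑ α, a α • P α) x = 2 * k * s := hx.2
  obtain ⟨hx1, hx0⟩ := (mem_phiLevel_iff ha hc _).1 hx
  refine (mem_focalMPlus_iff P _).2 ⟨?_, fun α => ?_⟩
  · refine (pow_eq_one_iff_of_nonneg (norm_nonneg _) two_ne_zero).1 ?_
    rw [norm_smul, mul_pow, hP.norm_sq_smul_add_smul ha, hq, hx1, Real.norm_eq_abs, sq_abs]
    have : (k ^ 2 + (-s) ^ 2) * 1 ^ 2 + 2 * k * -s * (2 * k * s) = (k ^ 2 - s ^ 2) ^ 2 := by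
      have h4 : (k ^ 2 + s ^ 2) ^ 2 = 1 := by rw [hks, one_pow]
      linear_combination hks - h4
    rw [this]
    field_simp
  · have h2 : ∀ y, quadForm (P α) ((k ^ 2 - s ^ 2)⁻¹ • y) =
        (k ^ 2 - s ^ 2)⁻¹ * ((k ^ 2 - s ^ 2)⁻¹ * quadForm (P α) y) := fun y => by
      simp only [quadForm, map_smul, inner_smul_left, inner_smul_right, RCLike.conj_to_real]
    rw [h2, hP.quadForm_smul_add_smul ha, hq, hx1, hx0]
    have : (k ^ 2 - (-s) ^ 2) * (2 * k * s * a α) + 2 * k * -s * a α * 1 ^ 2 +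
        2 * (-s) ^ 2 * a α * (2 * k * s) = 0 := by
      linear_combination 2 * k * s * a α * hks
    rw [this, mul_zero, mul_zero]

theorem unshear_shear (ha : ∑ α, a α ^ 2 = 1) (hks' : k ^ 2 - s ^ 2 ≠ 0)
    (x : EuclideanSpace ℝ (Fin (2 * l))) :
    (k ^ 2 - s ^ 2)⁻¹ • (k • (k • x + s • act (∑ α, a α • P α) x) +
      (-s) • act (∑ α, a α • P α) (k • x + s • act (∑ α, a α • P α) x)) = x := by
  rw [inv_smul_eq_iff₀ hks', map_add, map_smul, map_smul, hP.act_sum_smul_involutive ha]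
  module

theorem shear_unshear (ha : ∑ α, a α ^ 2 = 1) (hks' : k ^ 2 - s ^ 2 ≠ 0)
    (x : EuclideanSpace ℝ (Fin (2 * l))) :
    k • ((k ^ 2 - s ^ 2)⁻¹ • (k • x + (-s) • act (∑ α, a α • P α) x)) +
      s • act (∑ α, a α • P α) ((k ^ 2 - s ^ 2)⁻¹ • (k • x + (-s) • act (∑ α, a α • P α) x)) =
      x := by
  rw [map_smul, smul_comm k, smul_comm s, ← smul_add, inv_smul_eq_iff₀ hks', map_add, map_smul,
    map_smul, hP.act_sum_smul_involutive ha]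
  module

omit hP in
theorem contDiff_shear (A : Matrix (Fin (2 * l)) (Fin (2 * l)) ℝ) (k s : ℝ) :
    ContDiff ℝ ∞ (fun x => k • x + s • act A x) :=
  (contDiff_id.const_smul k).add ((act A).contDiff.const_smul s)

theorem isDiffeomorphism_shear (ha : ∑ α, a α ^ 2 = 1) (hks : k ^ 2 + s ^ 2 = 1)
    (hks' : k ^ 2 - s ^ 2 ≠ 0) (hc : (2 * k * s) ^ 2 = (1 - c) / 2) :
    IsDiffeomorphism (fun x => k • x + s • act (∑ α, a α • P α) x) (focalMPlus P)
      (phiLevel (fkmLevel P c) (∑ α, a α • P α) (2 * k * s)) :=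
  .of_contDiff (contDiff_shear _ k s) ((contDiff_shear _ k (-s)).const_smul _)
    (hP.mapsTo_shear ha hks hc) (hP.mapsTo_unshear ha hks hks' hc)
    ⟨fun x _ => hP.unshear_shear ha hks' x, fun x _ => hP.shear_unshear ha hks' x⟩

/-- Passes through M₊: undo the shear with s, then apply the one with -s. -/
theorem exists_isDiffeomorphism_phiLevel_neg (ha : ∑ α, a α ^ 2 = 1) (hks : k ^ 2 + s ^ 2 = 1)
    (hks' : k ^ 2 - s ^ 2 ≠ 0) (hc : (2 * k * s) ^ 2 = (1 - c) / 2) :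
    ∃ g, IsDiffeomorphism g (phiLevel (fkmLevel P c) (∑ α, a α • P α) (2 * k * s))
      (phiLevel (fkmLevel P c) (∑ α, a α • P α) (2 * k * -s)) := by
  have n1 : k ^ 2 + (-s) ^ 2 = 1 := by rwa [neg_sq]
  have n2 : k ^ 2 - (-s) ^ 2 ≠ 0 := by rwa [neg_sq]
  have n3 : (2 * k * -s) ^ 2 = (1 - c) / 2 := by rw [← hc]; ring
  refine ⟨_, .of_contDiff
    ((contDiff_shear (∑ α, a α • P α) k (-s)).comp
      ((contDiff_shear (∑ α, a α • P α) k (-s)).const_smul (k ^ 2 - s ^ 2)⁻¹))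
    ((contDiff_shear (∑ α, a α • P α) k s).comp
      ((contDiff_shear (∑ α, a α • P α) k (-(-s))).const_smul (k ^ 2 - (-s) ^ 2)⁻¹))
    ((hP.mapsTo_shear ha n1 n3).comp (hP.mapsTo_unshear ha hks hks' hc))
    ((hP.mapsTo_shear ha hks hc).comp (hP.mapsTo_unshear ha n1 n2 n3))
    ⟨fun x _ => ?_, fun x _ => ?_⟩⟩
  · simp only [Function.comp_apply]
    rw [hP.unshear_shear ha n2, hP.shear_unshear ha hks']
  · simp only [Function.comp_apply]
    rw [hP.unshear_shear ha hks', hP.shear_unshear ha n2]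

end Shear

omit hP in
theorem quadForm_sq_le {a : Fin (m + 1) → ℝ} (ha : ∑ α, a α ^ 2 = 1) {c : ℝ}
    {x : EuclideanSpace ℝ (Fin (2 * l))} (hx : x ∈ fkmLevel P c) :
    quadForm (∑ α, a α • P α) x ^ 2 ≤ (1 - c) / 2 := by
  have := Finset.sum_mul_sq_le_sq_mul_sq Finset.univ a fun α => quadForm (P α) x
  rwa [← quadForm_sum_smul, ha, one_mul, ((mem_fkmLevel_iff P c x).1 hx).2] at this

omit hP in
-- Cauchy–Schwarz gives the upper bound; a point where it is attained identifies it as the maximum.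
theorem focalNPlus_eq {a : Fin (m + 1) → ℝ} (ha : ∑ α, a α ^ 2 = 1) {c : ℝ}
    (hne : (phiLevel (fkmLevel P c) (∑ α, a α • P α) (√((1 - c) / 2))).Nonempty) :
    focalNPlus (fkmLevel P c) (∑ α, a α • P α) =
      phiLevel (fkmLevel P c) (∑ α, a α • P α) (√((1 - c) / 2)) := by
  have hle : ∀ x ∈ fkmLevel P c, quadForm (∑ α, a α • P α) x ≤ √((1 - c) / 2) :=
    fun x hx => Real.le_sqrt_of_sq_le (quadForm_sq_le ha hx)
  obtain ⟨z, hz, hzq⟩ := hne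
  ext x
  refine and_congr_right fun hx => ⟨fun h => (hle x hx).antisymm (hzq ▸ h hz), fun h y hy => ?_⟩
  exact (hle y hy).trans h.ge

omit hP in
theorem focalNMinus_eq {a : Fin (m + 1) → ℝ} (ha : ∑ α, a α ^ 2 = 1) {c : ℝ}
    (hne : (phiLevel (fkmLevel P c) (∑ α, a α • P α) (-√((1 - c) / 2))).Nonempty) :
    focalNMinus (fkmLevel P c) (∑ α, a α • P α) =
      phiLevel (fkmLevel P c) (∑ α, a α • P α) (-√((1 - c) / 2)) := by
  have hle : ∀ x ∈ fkmLevel P c, -√((1 - c) / 2) ≤ quadForm (∑ α, a α • P α) x :=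
    fun x hx => (abs_le.1 (Real.abs_le_sqrt (quadForm_sq_le ha hx))).1
  obtain ⟨z, hz, hzq⟩ := hne
  ext x
  refine and_congr_right fun hx => ⟨fun h => le_antisymm (hzq ▸ h hz) (hle x hx),
    fun h y hy => ?_⟩
  exact h.le.trans (hle y hy)

end IsCliffordSystem
end Clifford

/-! ### The trace identity behind minimality. -/

section CliffordPair

variable {E : Type*} [NormedAddCommGroup E] [InnerProductSpace ℝ E]

/-- For anticommuting symmetric involutions `R`, `T`, the operator `T` is traceless on the
orthogonal complement of `x`, `R x` and `T x`, if `x` is a unit vector with `⟪T x, x⟫ = 0`. -/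
theorem traceless_on_complement {d : ℕ} (hd : Module.finrank ℝ E = d + 3) {R T : E →L[ℝ] E}
    (hR : ∀ x y : E, ⟪R x, y⟫ = ⟪x, R y⟫) (hT : ∀ x y : E, ⟪T x, y⟫ = ⟪x, T y⟫)
    (hRR : ∀ x, R (R x) = x) (hTT : ∀ x, T (T x) = x) (hRT : ∀ x, R (T x) = -T (R x))
    {x : E} (hx : ‖x‖ = 1) {ρ : ℝ} (hRx : ⟪R x, x⟫ = ρ) (hTx : ⟪T x, x⟫ = 0) (hρ : ρ ^ 2 < 1)
    {e : Fin d → E} (he : Orthonormal ℝ e) (hxe : ∀ i, ⟪x, e i⟫ = 0) (hRe : ∀ i, ⟪R x, e i⟫ = 0)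
    (hTe : ∀ i, ⟪T x, e i⟫ = 0) :
    ∑ i, ⟪T (e i), e i⟫ = 0 ∧
      ∀ w, (∀ i, ⟪e i, w⟫ = 0) → ⟪x, w⟫ = 0 → ⟪R x, w⟫ = 0 → ∃ r : ℝ, w = r • T x := by
  have hxx : ⟪x, x⟫ = 1 := by rw [real_inner_self_eq_norm_sq, hx, one_pow]
  have hRR' : ⟪R x, R x⟫ = 1 := by rw [hR, hRR, hxx]
  have hTT' : ⟪T x, T x⟫ = 1 := by rw [hT, hTT, hxx]
  have hTRR : ⟪T (R x), R x⟫ = 0 := by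
    rw [← neg_neg (T (R x)), ← hRT, inner_neg_left, hR, hRR, hTx, neg_zero]
  have hTR : ⟪T x, R x⟫ = 0 := by
    have h1 : ⟪T x, R x⟫ = ⟪R (T x), x⟫ := by rw [hR]
    have h2 : ⟪T x, R x⟫ = ⟪T (R x), x⟫ := by rw [hT, hT, real_inner_comm, hT]
    rw [hRT, inner_neg_left] at h1
    linarith
  set δ := √(1 - ρ ^ 2) with hδ
  have hδ0 : δ ≠ 0 := (Real.sqrt_pos.2 (by linarith)).ne'
  have hδ2 : δ ^ 2 = 1 - ρ ^ 2 := Real.sq_sqrt (by linarith)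
  -- The normalised component of R x orthogonal to x, so that x, y, T x are orthonormal.
  set y := δ⁻¹ • (R x - ρ • x) with hy
  have hxR : ⟪x, R x⟫ = ρ := by rw [← hR, hRx]
  have hxT : ⟪x, T x⟫ = 0 := by rw [← hT, hTx]
  have hyy : ⟪y, y⟫ = 1 := by
    simp only [hy, inner_smul_left, inner_smul_right, inner_sub_left, inner_sub_right, hRR', hRx,
      hxR, hxx, RCLike.conj_to_real]
    field_simp
    rw [hδ2]
    ring
  have hxy : ⟪x, y⟫ = 0 := by
    simp only [hy, inner_smul_right, inner_sub_right, hxR, hxx]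
    ring
  have hTy : ⟪T x, y⟫ = 0 := by
    simp only [hy, inner_smul_right, inner_sub_right, hTR, hTx]
    ring
  have hTyy : ⟪T y, y⟫ = 0 := by
    have : ⟪T (R x), x⟫ = 0 := by rw [hT, real_inner_comm, hTR]
    simp only [hy, inner_smul_left, inner_smul_right, inner_sub_left, inner_sub_right, map_smul,
      map_sub, hTRR, hTR, hTx, this]
    ring
  set u : Fin 3 → E := ![x, y, T x] with hu
  have huo : Orthonormal ℝ u := by
    rw [orthonormal_iff_ite]
    intro i j
    have hyx : ⟪y, x⟫ = 0 := by rw [real_inner_comm, hxy]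
    have hyT : ⟪y, T x⟫ = 0 := by rw [real_inner_comm, hTy]
    fin_cases i <;> fin_cases j
    exacts [hxx, hxy, hxT, hyx, hyy, hyT, hTx, hTy, hTT']
  have hue : ∀ j i, ⟪u j, e i⟫ = 0 := by
    intro j i
    fin_cases j
    · exact hxe i
    · simp [hu, hy, inner_smul_left, inner_sub_left, hRe, hxe]
    · exact hTe i
  have hv : Orthonormal ℝ (Sum.elim e u) := by
    rw [orthonormal_iff_ite] at he huo ⊢
    rintro (i | i) (j | j)
    · simpa using he i j
    · simp [real_inner_comm (u j), hue]
    · simp [hue]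
    · simpa using huo i j
  set b := (basisOfOrthonormalOfCardEqFinrank hv (by simp [hd])).toOrthonormalBasis
    (by rwa [coe_basisOfOrthonormalOfCardEqFinrank]) with hb
  have hbv : ⇑b = Sum.elim e u := by
    rw [hb, Module.Basis.coe_toOrthonormalBasis, coe_basisOfOrthonormalOfCardEqFinrank]
  constructor
  · have htr : LinearMap.trace ℝ E T.toLinearMap = 0 := by
      have h1 : R.toLinearMap * (T.toLinearMap * R.toLinearMap) = -T.toLinearMap := by
        ext z
        change R (T (R z)) = -T z
        rw [hRT, hRR]
      have h2 : (T.toLinearMap * R.toLinearMap) * R.toLinearMap = T.toLinearMap := by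
        ext z
        change T (R (R z)) = T z
        rw [hRR]
      have h3 := LinearMap.trace_mul_comm ℝ R.toLinearMap (T.toLinearMap * R.toLinearMap)
      rw [h1, h2, map_neg] at h3
      linarith
    rw [LinearMap.trace_eq_sum_inner _ b, Fintype.sum_sum_type, Fin.sum_univ_three] at htr
    rw [hbv] at htr
    change ∑ i, ⟪e i, T (e i)⟫ + (⟪x, T x⟫ + ⟪y, T y⟫ + ⟪T x, T (T x)⟫) = 0 at htr
    rw [hTT, hxT, hTx, ← hT y, hTyy, add_zero, add_zero, add_zero] at htr
    rw [← htr]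
    exact Finset.sum_congr rfl fun i _ => hT _ _
  · intro w h1 h2 h3
    refine ⟨⟪T x, w⟫, ?_⟩
    have h4 : ⟪y, w⟫ = 0 := by
      simp [hy, inner_smul_left, inner_sub_left, h2, h3]
    conv_lhs => rw [← b.sum_repr' w]
    rw [Fintype.sum_sum_type, Fin.sum_univ_three]
    simp [hbv, hu, h1, h2, h4]

end CliffordPair

/-! ### The case m = 1: minimality of all level sets. -/

section Improper

variable {l : ℕ} {P : Fin (1 + 1) → Matrix (Fin (2 * l)) (Fin (2 * l)) ℝ}

/-- Around each of its points, a level set of `x ↦ ⟪Q x, x⟫` in an FKM-type hypersurface with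
`m = 1` is a common level set of the two quadratic forms. -/
theorem phiLevel_locally_commonLevel {a : Fin (1 + 1) → ℝ} (ha : ∑ α, a α ^ 2 = 1)
    {c τ : ℝ} {x : EuclideanSpace ℝ (Fin (2 * l))}
    (hx : x ∈ phiLevel (fkmLevel P c) (∑ α, a α • P α) τ) :
    ∃ U : Set (EuclideanSpace ℝ (Fin (2 * l))), IsOpen U ∧ x ∈ U ∧ ∀ y ∈ U,
      y ∈ phiLevel (fkmLevel P c) (∑ α, a α • P α) τ ↔
        ‖y‖ = 1 ∧ ∀ α, quadForm (P α) y = quadForm (P α) x := by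
  -- The form of the Clifford element orthogonal to Q. The pair (⟨Qy,y⟩, q y) is a rotation of the
  -- two given forms up to sign conventions, so q² is constant on the level set.
  set q : EuclideanSpace ℝ (Fin (2 * l)) → ℝ :=
    fun y => a 0 * quadForm (P 1) y - a 1 * quadForm (P 0) y with hq
  have hqc : Continuous q :=
    (continuous_const.mul (contDiff_quadForm (P 1)).continuous).sub
      (continuous_const.mul (contDiff_quadForm (P 0)).continuous)
  have hL : ∀ y, y ∈ phiLevel (fkmLevel P c) (∑ α, a α • P α) τ ↔
      (‖y‖ = 1 ∧ quadForm (P 0) y ^ 2 + quadForm (P 1) y ^ 2 = (1 - c) / 2) ∧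
        a 0 * quadForm (P 0) y + a 1 * quadForm (P 1) y = τ := by
    intro y
    simp only [phiLevel, Set.mem_ofPred_eq, mem_fkmLevel_iff, quadForm_sum_smul]
    rw [Fin.sum_univ_two, Fin.sum_univ_two]
  have ha' : a 0 ^ 2 + a 1 ^ 2 = 1 := by simpa [Fin.sum_univ_two] using ha
  have hqsq : ∀ y, y ∈ phiLevel (fkmLevel P c) (∑ α, a α • P α) τ →
      q y ^ 2 = (1 - c) / 2 - τ ^ 2 := by
    intro y hy
    obtain ⟨⟨_, h1⟩, h2⟩ := (hL y).1 hy
    rw [← h1, ← h2]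
    simp only [hq]
    linear_combination (quadForm (P 0) y ^ 2 + quadForm (P 1) y ^ 2) * ha'
  obtain ⟨⟨hx1, hx2⟩, hx3⟩ := (hL x).1 hx
  -- Excludes the other square root -q x; when q x = 0 there is only one root and the neighbourhood
  -- is the whole space.
  refine ⟨{y | q x = 0 ∨ q y ≠ -q x}, ?_, ?_, fun y hy => ?_⟩
  · by_cases h : q x = 0
    · simp [h]
    · simpa [h] using isOpen_ne_fun hqc continuous_const
  · by_cases h : q x = 0
    · exact Or.inl h
    · refine Or.inr fun h' => h ?_
      linarith
  · constructor
    · intro hyL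
      obtain ⟨⟨hy1, hy2⟩, hy3⟩ := (hL y).1 hyL
      have hqq : q y = q x := by
        rcases sq_eq_sq_iff_eq_or_eq_neg.1 ((hqsq y hyL).trans (hqsq x hx).symm) with h | h
        · exact h
        · rcases hy with h0 | h0
          · rw [h, h0, neg_zero]
          · exact absurd h h0
      simp only [hq] at hqq
      refine ⟨hy1, fun α => ?_⟩
      fin_cases α
      · change quadForm (P 0) y = quadForm (P 0) x
        linear_combination (quadForm (P 0) x - quadForm (P 0) y) * ha' +
          a 0 * (hy3 - hx3) - a 1 * hqq
      · change quadForm (P 1) y = quadForm (P 1) x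
        linear_combination (quadForm (P 1) x - quadForm (P 1) y) * ha' +
          a 1 * (hy3 - hx3) + a 0 * hqq
    · rintro ⟨hy1, hy2⟩
      refine (hL y).2 ⟨⟨hy1, ?_⟩, ?_⟩
      · rw [hy2, hy2, hx2]
      · rw [hy2, hy2, hx3]

variable (hP : IsCliffordSystem P)
include hP

theorem IsCliffordSystem.isSubmanifold_phiLevel_of_improper {a : Fin (1 + 1) → ℝ}
    (ha : ∑ α, a α ^ 2 = 1) {c : ℝ} (hc : -1 < c) (τ : ℝ) :
    IsSubmanifold (2 * l - 3) (phiLevel (fkmLevel P c) (∑ α, a α • P α) τ) := by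
  refine .of_locally fun x hx => ?_
  obtain ⟨U, hU, hxU, h⟩ := phiLevel_locally_commonLevel ha hx
  refine ⟨U, _, hU, hxU, hP.isSubmanifold_commonLevel (b := fun α => quadForm (P α) x) ?_, h⟩
  rw [((mem_fkmLevel_iff P c x).1 hx.1).2]
  linarith

/-- In the improper case `m = 1` the level sets of `x ↦ ⟪Q x, x⟫` are minimal in the
hypersurface. -/
theorem IsCliffordSystem.isMinimalIn_phiLevel {a : Fin (1 + 1) → ℝ} (hl : 2 ≤ l)
    (ha : ∑ α, a α ^ 2 = 1) {c : ℝ} (hc : c ∈ Set.Ioo (-1 : ℝ) 1)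
    (hM : IsSubmanifold (2 * l - 2) (fkmLevel P c)) (τ : ℝ) :
    IsMinimalIn (2 * l - 2) (2 * l - 3) (fkmLevel P c)
      (phiLevel (fkmLevel P c) (∑ α, a α • P α) τ) where
  ambient := hM
  submanifold := hP.isSubmanifold_phiLevel_of_improper ha hc.1 τ
  subset := fun x hx => hx.1
  mean_curvature_eq_zero := by
    intro x hx
    set S := phiLevel (fkmLevel P c) (∑ α, a α • P α) τ with hS
    intro e γ hγ
    obtain ⟨U, hU, hxU, hloc⟩ := phiLevel_locally_commonLevel ha hx
    obtain ⟨hx1, hx2⟩ := (mem_fkmLevel_iff P c x).1 hx.1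
    set b : Fin (1 + 1) → ℝ := fun α => quadForm (P α) x with hb
    set ρ := √((1 - c) / 2) with hρ
    have hρ2 : ρ ^ 2 = (1 - c) / 2 := Real.sq_sqrt (by linarith [hc.2])
    have hρ0 : ρ ≠ 0 := (Real.sqrt_pos.2 (by linarith [hc.2])).ne'
    have hbρ : b 0 ^ 2 + b 1 ^ 2 = ρ ^ 2 := by
      rw [hρ2, ← hx2, Fin.sum_univ_two]
    -- Orthonormal frame of the Clifford plane adapted to x: v points along the values b, making R x
    -- normal to M, and w is v turned by a right angle.
    set v : Fin (1 + 1) → ℝ := ![b 0 / ρ, b 1 / ρ] with hv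
    set w : Fin (1 + 1) → ℝ := ![-(b 1 / ρ), b 0 / ρ] with hw
    have hv1 : ∑ α, v α ^ 2 = 1 := by
      rw [Fin.sum_univ_two]
      change (b 0 / ρ) ^ 2 + (b 1 / ρ) ^ 2 = 1
      field_simp
      exact hbρ
    have hw1 : ∑ α, w α ^ 2 = 1 := by
      rw [Fin.sum_univ_two]
      change (-(b 1 / ρ)) ^ 2 + (b 0 / ρ) ^ 2 = 1
      field_simp
      linarith
    have hvw : ∑ α, v α * w α = 0 := by
      rw [Fin.sum_univ_two]
      change b 0 / ρ * -(b 1 / ρ) + b 1 / ρ * (b 0 / ρ) = 0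
      ring
    set R := act (∑ α, v α • P α) with hR
    set T := act (∑ α, w α • P α) with hT
    have hRs : ∀ x y, ⟪R x, y⟫ = ⟪x, R y⟫ := inner_act_left (hP.isSymm_sum_smul v)
    have hTs : ∀ x y, ⟪T x, y⟫ = ⟪x, T y⟫ := inner_act_left (hP.isSymm_sum_smul w)
    have hRT : ∀ x, R (T x) = -T (R x) := fun x => by
      have := hP.act_sum_smul_anticomm v w x
      rw [hvw, mul_zero, zero_smul] at this
      exact eq_neg_of_add_eq_zero_left this
    have hRx : ⟪R x, x⟫ = ρ := by
      have : quadForm (∑ α, v α • P α) x = ρ := by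
        rw [quadForm_sum_smul, Fin.sum_univ_two]
        change b 0 / ρ * b 0 + b 1 / ρ * b 1 = ρ
        field_simp
        exact hbρ
      exact this
    have hTx : ⟪T x, x⟫ = 0 := by
      have : quadForm (∑ α, w α • P α) x = 0 := by
        rw [quadForm_sum_smul, Fin.sum_univ_two]
        change -(b 1 / ρ) * b 0 + b 0 / ρ * b 1 = 0
        ring
      exact this
    have hcurve : ∀ δ, IsCurveIn S x δ → ∀ᶠ t in 𝓝 (0 : ℝ),
        ‖δ t‖ = 1 ∧ ∀ α, quadForm (P α) (δ t) = b α := by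
      intro δ hδ
      have hδU : ∀ᶠ t in 𝓝 (0 : ℝ), δ t ∈ U := by
        refine hδ.contDiffAt.continuousAt.eventually_mem ?_
        rw [hδ.1]
        exact hU.mem_nhds hxU
      filter_upwards [hδ.eventually_mem, hδU] with t h1 h2 using (hloc _ h2).1 h1
    have hcurve1 : ∀ A δ, IsCurveIn A x δ → (∀ᶠ t in 𝓝 (0 : ℝ), ‖δ t‖ = 1) →
        ⟪x, deriv δ 0⟫ = 0 := by
      intro A δ hδ hn
      refine (hδ.inner_eq_zero_of_const (T := ContinuousLinearMap.id ℝ _) (fun _ _ => rfl)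
        (b := 1) ?_).1
      filter_upwards [hn] with t ht
      change ⟪δ t, δ t⟫ = 1
      rw [real_inner_self_eq_norm_sq, ht, one_pow]
    have hcurveQ : ∀ (d : Fin (1 + 1) → ℝ) (δ), IsCurveIn S x δ → ∀ᶠ t in 𝓝 (0 : ℝ),
        ⟪act (∑ α, d α • P α) (δ t), δ t⟫ = ∑ α, d α * b α := by
      intro d δ hδ
      filter_upwards [hcurve δ hδ] with t ht
      change quadForm _ _ = _
      rw [quadForm_sum_smul]
      exact Finset.sum_congr rfl fun α _ => by rw [ht.2]
    have hcurveM : ∀ δ, IsCurveIn (fkmLevel P c) x δ → ⟪R x, deriv δ 0⟫ = 0 := by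
      intro δ hδ
      have hd := hδ.hasDerivAt
      have h1 : HasDerivAt (fun t => ∑ α, quadForm (P α) (δ t) ^ 2)
          (∑ α, 2 * b α * (2 * ⟪act (P α) x, deriv δ 0⟫)) 0 := by
        refine HasDerivAt.fun_sum fun α _ => ?_
        have := (hasDerivAt_inner_self_symm (inner_act_left (hP.symm α)) hd).pow 2
        refine this.congr_deriv ?_
        simp only [hδ.1, hb, quadForm]
        norm_num
      have h2 : HasDerivAt (fun t => ∑ α, quadForm (P α) (δ t) ^ 2) 0 0 := by
        refine (hasDerivAt_const (0 : ℝ) ((1 - c) / 2)).congr_of_eventuallyEq ?_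
        filter_upwards [hδ.eventually_mem] with t ht using ((mem_fkmLevel_iff P c _).1 ht).2
      have h3 := h1.unique h2
      have h4 : ∀ y, ⟪R x, y⟫ = ρ⁻¹ * ∑ α, b α * ⟪act (P α) x, y⟫ := by
        intro y
        simp [hR, hv, Fin.sum_univ_two, act_add, act_smul, inner_add_left, inner_smul_left]
        ring
      rw [h4, mul_eq_zero]
      right
      rw [Fin.sum_univ_two] at h3 ⊢
      linarith
    have hTS : ∀ y ∈ tangentSpaceAt S x, ⟪x, y⟫ = 0 ∧ ⟪R x, y⟫ = 0 ∧ ⟪T x, y⟫ = 0 := fun y hy =>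
      ⟨tangentSpaceAt_le_orthogonal
        (fun δ hδ => hcurve1 S δ hδ ((hcurve δ hδ).mono fun _ h => h.1)) hy,
      tangentSpaceAt_le_orthogonal
        (fun δ hδ => (hδ.inner_eq_zero_of_const hRs (hcurveQ v δ hδ)).1) hy,
      tangentSpaceAt_le_orthogonal
        (fun δ hδ => (hδ.inner_eq_zero_of_const hTs (hcurveQ w δ hδ)).1) hy⟩
    have heo : Orthonormal ℝ fun i => (e i : EuclideanSpace ℝ (Fin (2 * l))) :=
      e.orthonormal.comp_linearIsometry (tangentSpaceAt S x).subtypeₗᵢ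
    obtain ⟨htr, hspan⟩ := traceless_on_complement (d := 2 * l - 3)
      (by rw [finrank_euclideanSpace_fin]; omega) hRs hTs (hP.act_sum_smul_involutive hv1)
      (hP.act_sum_smul_involutive hw1) hRT hx1 hRx hTx (by rw [hρ2]; linarith [hc.1]) heo
      (fun i => (hTS _ (e i).2).1) (fun i => (hTS _ (e i).2).2.1)
      (fun i => (hTS _ (e i).2).2.2)
    -- Normal vectors of S in M are multiples of T x, so it suffices to pair the total acceleration
    -- with T x.
    rw [← map_sum, Submodule.starProjection_apply_eq_zero_iff, Submodule.mem_orthogonal]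
    intro y hy
    obtain ⟨hyM, hyS⟩ := Submodule.mem_inf.1 hy
    obtain ⟨r, rfl⟩ := hspan y
      (fun i => (Submodule.mem_orthogonal _ _).1 hyS _ (e i).2)
      (tangentSpaceAt_le_orthogonal (fun δ hδ => hcurve1 _ δ hδ
        (hδ.eventually_mem.mono fun _ h => ((mem_fkmLevel_iff P c _).1 h).1)) hyM)
      (tangentSpaceAt_le_orthogonal hcurveM hyM)
    rw [inner_smul_left, inner_sum]
    have : ∀ i, ⟪T x, deriv (deriv (γ i)) 0⟫ = -⟪T (e i), e i⟫ := fun i => by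
      rw [((hγ i).1.inner_eq_zero_of_const hTs (hcurveQ w _ (hγ i).1)).2, (hγ i).2]
    rw [Finset.sum_congr rfl fun i _ => this i, Finset.sum_neg_distrib, htr, neg_zero, mul_zero]

end Improper

end FKM

theorem lemma2 (l m : ℕ) (hm : 1 ≤ m) (hl : m + 1 < l)
    (P : Fin (m + 1) → Matrix (Fin (2 * l)) (Fin (2 * l)) ℝ) (hP : FKM.IsCliffordSystem P)
    (Q : Matrix (Fin (2 * l)) (Fin (2 * l)) ℝ) (hQ : Q ∈ FKM.cliffordSphere P)
    (c : ℝ) (hc : c ∈ Set.Ioo (-1 : ℝ) 1)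
    (M : Set (EuclideanSpace ℝ (Fin (2 * l)))) (hMc : M = FKM.fkmLevel P c)
    (hM : FKM.IsMinimalIn (2 * l - 1) (2 * l - 2) (FKM.unitSphere l) M) :
    -- the three focal sets, explicitly
    FKM.focalMPlus P = {x | x ∈ FKM.unitSphere l ∧ ∀ α, FKM.quadForm (P α) x = 0} ∧
    FKM.focalNPlus M Q = FKM.phiLevel M Q (√((1 - c) / 2)) ∧
    FKM.focalNMinus M Q = FKM.phiLevel M Q (-√((1 - c) / 2)) ∧
    -- they are submanifolds of dimension `n - m`, where `n = 2l - 2`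
    FKM.IsSubmanifold (2 * l - 2 - m) (FKM.focalMPlus P) ∧
    FKM.IsSubmanifold (2 * l - 2 - m) (FKM.focalNPlus M Q) ∧
    FKM.IsSubmanifold (2 * l - 2 - m) (FKM.focalNMinus M Q) ∧
    -- they are diffeomorphic
    (∃ t : ℝ, Real.cos t = √((1 + √((1 + c) / 2)) / 2) ∧
      Real.sin t = √((1 - √((1 + c) / 2)) / 2) ∧
      FKM.IsDiffeomorphism (fun x => Real.cos t • x + Real.sin t • FKM.act Q x)
        (FKM.focalMPlus P) (FKM.focalNPlus M Q) ∧
      FKM.IsDiffeomorphism (fun x => Real.cos t • x - Real.sin t • FKM.act Q x)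
        (FKM.focalMPlus P) (FKM.focalNMinus M Q)) ∧
    (∃ g : EuclideanSpace ℝ (Fin (2 * l)) → EuclideanSpace ℝ (Fin (2 * l)),
      FKM.IsDiffeomorphism g (FKM.focalNPlus M Q) (FKM.focalNMinus M Q)) ∧
    -- the improper case
    (m = 1 → ∀ τ ∈ Set.Icc (-√((1 - c) / 2)) (√((1 - c) / 2)),
      FKM.IsMinimalIn (2 * l - 2) (2 * l - 3) M (FKM.phiLevel M Q τ)) := by
  subst hMc
  obtain ⟨a, ha, rfl⟩ := hQ
  obtain ⟨hc1, hc2⟩ := hc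
  set ρ := √((1 - c) / 2) with hρ
  set σ := √((1 + c) / 2) with hσ
  have hρ2 : ρ ^ 2 = (1 - c) / 2 := Real.sq_sqrt (by linarith)
  have hσ2 : σ ^ 2 = (1 + c) / 2 := Real.sq_sqrt (by linarith)
  have hσ0 : 0 < σ := Real.sqrt_pos.2 (by linarith)
  have hσ1 : σ ≤ 1 := by
    rw [hσ, Real.sqrt_le_one]
    linarith
  -- Half-angle formulas: k = cos t and s = sin t, where cos 2t = k² - s² = σ and sin 2t = 2ks = ρ.
  set k := √((1 + σ) / 2) with hk
  set s := √((1 - σ) / 2) with hs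
  have hk2 : k ^ 2 = (1 + σ) / 2 := Real.sq_sqrt (by linarith)
  have hs2 : s ^ 2 = (1 - σ) / 2 := Real.sq_sqrt (by linarith)
  have hks : k ^ 2 + s ^ 2 = 1 := by rw [hk2, hs2]; ring
  have hks' : k ^ 2 - s ^ 2 ≠ 0 := by
    rw [hk2, hs2]
    have : (1 + σ) / 2 - (1 - σ) / 2 = σ := by ring
    rw [this]
    exact hσ0.ne'
  have hρks : 2 * k * s = ρ := by
    refine (sq_eq_sq₀ (by positivity) (Real.sqrt_nonneg _)).1 ?_
    rw [hρ2, mul_pow, mul_pow, hk2, hs2]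
    linarith
  have hρks' : 2 * k * -s = -ρ := by rw [← hρks]; ring
  have hc : (2 * k * s) ^ 2 = (1 - c) / 2 := by rw [hρks, hρ2]
  have hd := hP.isDiffeomorphism_shear ha hks hks' hc
  have hd' := hP.isDiffeomorphism_shear (k := k) (s := -s) (c := c) ha (by rwa [neg_sq]) (by rwa [neg_sq])
    (by rw [hρks', neg_sq, hρ2])
  have hg := hP.exists_isDiffeomorphism_phiLevel_neg ha hks hks' hc
  rw [hρks] at hd hg
  rw [hρks'] at hd' hg
  -- The images of z under the two shears attain the bounds ±ρ.
  obtain ⟨z, hz⟩ := hP.focalMPlus_nonempty hm hl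
  have hNp := FKM.IsCliffordSystem.focalNPlus_eq ha ⟨_, hd.1 hz⟩
  have hNm := FKM.IsCliffordSystem.focalNMinus_eq ha ⟨_, hd'.1 hz⟩
  rw [hNp, hNm]
  have hcos : Real.cos (Real.arccos k) = k :=
    Real.cos_arccos (by linarith [Real.sqrt_nonneg ((1 + σ) / 2)])
      (Real.sqrt_le_one.2 (by linarith))
  have hsin : Real.sin (Real.arccos k) = s := by
    rw [Real.sin_arccos, hk2, hs]
    congr 1
    ring
  refine ⟨FKM.focalMPlus_eq P, rfl, rfl, hP.isSubmanifold_focalMPlus,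
    hP.isSubmanifold_phiLevel ha hρ2 hc1, hP.isSubmanifold_phiLevel ha (by rw [neg_sq, hρ2]) hc1,
    ⟨Real.arccos k, ?_, ?_, ?_⟩, hg, ?_⟩
  · exact hcos
  · exact hsin
  · rw [hcos, hsin]
    refine ⟨hd, ?_⟩
    simpa only [neg_smul, ← sub_eq_add_neg] using hd'
  · rintro rfl τ _
    exact hP.isMinimalIn_phiLevel (by omega) ha ⟨hc1, hc2⟩ hM.submanifold τ
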